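/- Let $n \ge 4$ be an even integer, let $D_{2n}$ be the dihedral group of order $2n$, and let $C_2$ be the cyclic group of order $2$. For a finite group $G$, a sequence over $G$ is a finite unordered family of elements of $G$ with repetition allowed; it is a product-one sequence if its terms can be ordered so that their product is $1$; and $\exp(G)$ is the least common multiple of the orders of the elements of $G$. Let $\mathsf{s}(G)$ (the Erdős–Ginzburg–Ziv constant) be the smallest integer $\ell > 0$ such that every sequence over $G$ of length at least $\ell$ has a product-one subsequence of length $\exp(G)$, and let $\eta(G)$ be the smallest integer $\ell > 0$ such that every sequence over $G$ of length at least $\ell$ has a product-one subsequence $T$ with $1 \le |T| \le \exp(G)$. Then $$\mathsf{s}(D_{2n} \times C_2) = 2n+2 \qquad\text{and}\qquad \eta(D_{2n} \times C_2) = n+3.$$ In particular, $\mathsf{s}(D_{2n} \times C_2) = \eta(D_{2n} \times C_2) + \exp(D_{2n} \times C_2) - 1$. -/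

import Mathlib

/-! Sequences over a group `G` are finite unordered families with repetition, i.e. elements of the
free abelian monoid with basis `G`; they are modelled by `Multiset G`. Subsequence is `T ≤ S`
(multiplicity-wise) and the length of `S` is `S.card`. -/

namespace ProductOne

/-- The set of products `π(S)`: the values of the products of the terms of `S`, over all
orderings of these terms. -/
def productSet {G : Type*} [Group G] (S : Multiset G) : Set G :=
  {g | ∃ l : List G, (l : Multiset G) = S ∧ l.prod = g}

/-- `S` is a product-one sequence if `1 ∈ π(S)`. -/
def IsProductOne {G : Type*} [Group G] (S : Multiset G) : Prop :=
  (1 : G) ∈ productSet S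

/-- A short product-one sequence: a product-one sequence of length between `1` and `exp(G)`. -/
def IsShortProductOne {G : Type*} [Group G] (S : Multiset G) : Prop :=
  IsProductOne S ∧ 1 ≤ S.card ∧ S.card ≤ Monoid.exponent G

/-- The `η`-constant: the smallest `ℓ > 0` such that every sequence over `G` of length at least
`ℓ` has a short product-one subsequence. (The value is `0` only if there is no such `ℓ`.) -/
noncomputable def etaConstant (G : Type*) [Group G] : ℕ :=
  sInf {ℓ : ℕ | 0 < ℓ ∧ ∀ S : Multiset G, ℓ ≤ S.card → ∃ T ≤ S, IsShortProductOne T}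

/-- The Erdős–Ginzburg–Ziv constant: the smallest `ℓ > 0` such that every sequence over `G` of
length at least `ℓ` has a product-one subsequence of length `exp(G)`. (The value is `0` only if
there is no such `ℓ`.) -/
noncomputable def egzConstant (G : Type*) [Group G] : ℕ :=
  sInf {ℓ : ℕ | 0 < ℓ ∧ ∀ S : Multiset G, ℓ ≤ S.card →
    ∃ T ≤ S, IsProductOne T ∧ T.card = Monoid.exponent G}

/-- The group `D_{2n} × C_2`. Mathlib's `DihedralGroup n` is the dihedral group of order `2n`. -/
abbrev DihedralTimesC2 (n : ℕ) : Type :=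
  DihedralGroup n × Multiplicative (ZMod 2)

end ProductOne

namespace ProductOne

open scoped Pointwise

/-! Upper bound. Everything follows from the claim that 2n + 2 terms always contain a product-one
subsequence of length n = exp, for even n ≥ 4 (`hasEGZ_two_mul`). The claim passes from n to np:
reducing angles modulo n has cyclic kernel of exponent p, so 2p - 1 disjoint blocks of length n with
products in the kernel can be combined by the Erdős–Ginzburg–Ziv theorem (`HasEGZ.mul`). This leaves
n = 2p with p prime.

There the terms are sorted by their class in D_4 × C_2, which is elementary abelian of order 8.
Pairs of equal class have product in the kernel, of order p, and the leftover L has distinct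
classes. If |L| ≤ 4 there are 2p - 1 pairs and Erdős–Ginzburg–Ziv suffices. Otherwise L misses at
most two classes and contains two reflections x, y and two rotations u, v with product in the
kernel. Terms placed between x and y are inverted, so a nontrivial pair offers at least two kernel
values; by Cauchy–Davenport (`Wide.add`) about p such pairs reach every kernel element, in
particular the inverse of the quadruple's product. Trivial pairs, being product-one already, serve
as padding. For p = 2 four terms of L suffice.

Lower bound. `extremalSeq` has n + 2 terms and no short product-one subsequence. Padding with n - 1
identities transfers this bound to the Erdős–Ginzburg–Ziv constant and, in the other direction,
turns the upper bound 2n + 2 into n + 3 for η. -/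

/-! ### Lifting and selecting subsequences -/

theorem exists_list_map_eq {α β : Type*} (f : α → β) :
    ∀ (l : List β) (S : Multiset α), (l : Multiset β) ≤ S.map f →
      ∃ l' : List α, (l' : Multiset α) ≤ S ∧ l'.map f = l := by
  classical
  intro l
  induction l with
  | nil => intro S _; exact ⟨[], by simp, rfl⟩
  | cons b l ih =>
    intro S h
    have hb : b ∈ S.map f := Multiset.mem_of_le h (by simp)
    obtain ⟨a, ha, rfl⟩ := Multiset.mem_map.1 hb
    obtain ⟨S', rfl⟩ := Multiset.exists_cons_of_mem ha
    rw [Multiset.map_cons, ← Multiset.cons_coe, Multiset.cons_le_cons_iff] at h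
    obtain ⟨l', hl', rfl⟩ := ih S' h
    exact ⟨a :: l', by rw [← Multiset.cons_coe]; exact Multiset.cons_le_cons a hl', rfl⟩

theorem exists_le_map_eq {α β : Type*} (f : α → β) (S : Multiset α) (T : Multiset β)
    (h : T ≤ S.map f) : ∃ T' ≤ S, T'.map f = T := by
  obtain ⟨l, rfl⟩ := Quot.exists_rep T
  obtain ⟨l', h1, h2⟩ := exists_list_map_eq f l S h
  exact ⟨l', h1, by rw [Multiset.map_coe, h2]; rfl⟩

theorem exists_le_card {α : Type*} (S : Multiset α) (k : ℕ) (h : k ≤ S.card) :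
    ∃ T ≤ S, T.card = k := by
  obtain ⟨l, rfl⟩ := Quot.exists_rep S
  exact ⟨(l.take k : List α), Multiset.coe_le.2 (List.take_sublist k l).subperm, by
    simpa using h⟩

theorem sum_map_le_sum_map {α β : Type*} (f : α → Multiset β) {S T : Multiset α} (h : S ≤ T) :
    (S.map f).sum ≤ (T.map f).sum := by
  obtain ⟨U, rfl⟩ := Multiset.le_iff_exists_add.1 h
  rw [Multiset.map_add, Multiset.sum_add]
  exact Multiset.le_add_right _ _

theorem card_sum_map {α β : Type*} (f : α → Multiset β) (k : ℕ) (S : Multiset α)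
    (h : ∀ a ∈ S, (f a).card = k) : (S.map f).sum.card = S.card * k := by
  induction S using Multiset.induction with
  | empty => simp
  | cons a S ih =>
    rw [Multiset.map_cons, Multiset.sum_cons, Multiset.card_add, h a (by simp),
      ih (fun b hb => h b (Multiset.mem_cons_of_mem hb)), Multiset.card_cons]
    ring

/-! ### Product-one sequences, blocks and pairings -/

section Group

variable {G H : Type*} [Group G] [Group H]

theorem prod_mem_productSet (l : List G) : l.prod ∈ productSet (l : Multiset G) := ⟨l, rfl, rfl⟩

theorem mul_mem_productSet {S T : Multiset G} {g h : G} (hg : g ∈ productSet S)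
    (hh : h ∈ productSet T) : g * h ∈ productSet (S + T) := by
  obtain ⟨l, rfl, rfl⟩ := hg
  obtain ⟨l', rfl, rfl⟩ := hh
  exact ⟨l ++ l', by simp, by simp⟩

theorem IsProductOne.add {S T : Multiset G} (hS : IsProductOne S) (hT : IsProductOne T) :
    IsProductOne (S + T) := by
  have := mul_mem_productSet hS hT
  rwa [one_mul] at this

theorem IsProductOne.sum_map {α : Type*} (f : α → Multiset G) (S : Multiset α)
    (h : ∀ a ∈ S, IsProductOne (f a)) : IsProductOne (S.map f).sum := by
  induction S using Multiset.induction with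
  | empty => exact ⟨[], by simp, rfl⟩
  | cons a S ih =>
    rw [Multiset.map_cons, Multiset.sum_cons]
    exact (h a (by simp)).add (ih fun b hb => h b (Multiset.mem_cons_of_mem hb))

/-- Disjoint blocks of length `k` whose products lie in the kernel of `φ`. -/
theorem exists_blocks (φ : G →* H) {ℓ k : ℕ}
    (hH : ∀ S : Multiset H, ℓ ≤ S.card → ∃ T ≤ S, IsProductOne T ∧ T.card = k) (j : ℕ) :
    ∀ S : Multiset G, ℓ + j * k ≤ S.card → ∃ 𝓛 : Multiset (List G), 𝓛.card = j + 1 ∧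
      (𝓛.map (fun l : List G => (l : Multiset G))).sum ≤ S ∧
      ∀ l ∈ 𝓛, l.length = k ∧ φ l.prod = 1 := by
  have key : ∀ S : Multiset G, ℓ ≤ S.card → ∃ l : List G, (l : Multiset G) ≤ S ∧
      l.length = k ∧ φ l.prod = 1 := by
    intro S hS
    obtain ⟨T, hT, ⟨l, rfl, hl⟩, hk⟩ := hH (S.map φ) (by simpa using hS)
    obtain ⟨l', hl', rfl⟩ := exists_list_map_eq φ l S hT
    exact ⟨l', hl', by simpa using hk, by rw [map_list_prod, hl]⟩
  induction j with
  | zero =>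
    intro S hS
    obtain ⟨l, h1, h2⟩ := key S (by simpa using hS)
    exact ⟨{l}, by simp, by simpa using h1, by simpa using h2⟩
  | succ j ih =>
    intro S hS
    obtain ⟨l, h1, h2⟩ := key S (by omega)
    obtain ⟨U, rfl⟩ := Multiset.le_iff_exists_add.1 h1
    have hU : ℓ + j * k ≤ U.card := by
      rw [Multiset.card_add, Multiset.coe_card, h2.1, add_mul] at hS
      omega
    obtain ⟨𝓛, h3, h4, h5⟩ := ih U hU
    refine ⟨l ::ₘ 𝓛, by simp [h3], ?_, ?_⟩
    · rw [Multiset.map_cons, Multiset.sum_cons]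
      gcongr
    · intro l' hl'
      rcases Multiset.mem_cons.1 hl' with rfl | hl'
      · exact h2
      · exact h5 l' hl'

/-- The Erdős–Ginzburg–Ziv theorem for blocks whose products are powers of an element `z`
with `z ^ p = 1`. -/
theorem exists_productOne_of_blocks {z : G} {p k : ℕ} (hz : z ^ p = 1) (𝓛 : Multiset (List G))
    (hcard : 2 * p - 1 ≤ 𝓛.card) (h : ∀ l ∈ 𝓛, l.length = k ∧ ∃ j : ℤ, l.prod = z ^ j) :
    ∃ T ≤ (𝓛.map (fun l : List G => (l : Multiset G))).sum,
      IsProductOne T ∧ T.card = p * k := by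
  classical
  have : ∃ v : List G → ℤ, ∀ l ∈ 𝓛, l.prod = z ^ v l := by
    choose! v hv using fun l hl => (h l hl).2
    exact ⟨v, hv⟩
  obtain ⟨v, hv⟩ := this
  obtain ⟨t, ht, htc, hts⟩ := Int.erdos_ginzburg_ziv_multiset (n := p) (𝓛.map v)
    (by rwa [Multiset.card_map])
  obtain ⟨𝓛', h𝓛', rfl⟩ := exists_le_map_eq v 𝓛 t ht
  refine ⟨_, sum_map_le_sum_map _ h𝓛', ?_, ?_⟩
  · have key : ∀ M : Multiset (List G), M ≤ 𝓛 →
        z ^ (M.map v).sum ∈ productSet (M.map (fun l : List G => (l : Multiset G))).sum := by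
      intro M
      induction M using Multiset.induction with
      | empty => intro _; exact ⟨[], by simp, by simp⟩
      | cons l M ih =>
        intro hM
        have h1 := ih ((Multiset.le_cons_self M l).trans hM)
        rw [Multiset.map_cons, Multiset.map_cons, Multiset.sum_cons, Multiset.sum_cons, zpow_add,
          ← hv l (Multiset.mem_of_le hM (by simp))]
        exact mul_mem_productSet (prod_mem_productSet l) h1
    have h1 := key 𝓛' h𝓛'
    obtain ⟨c, hc⟩ := hts
    rw [hc, zpow_mul, zpow_natCast, hz, one_zpow] at h1
    exact h1
  · rw [card_sum_map _ k]
    · rw [← htc, Multiset.card_map]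
    · intro l hl
      simpa using (h l (Multiset.mem_of_le h𝓛' hl)).1

/-- A sequence splits into pairs on which `f` is constant and a rest on which `f` is injective. -/
theorem exists_pairing {α β : Type*} (f : α → β) (S : Multiset α) :
    ∃ (P : Multiset (α × α)) (L : Multiset α),
      S = (P.map (fun q => ({q.1, q.2} : Multiset α))).sum + L ∧
      (∀ q ∈ P, f q.1 = f q.2) ∧ (L.map f).Nodup := by
  classical
  induction S using Multiset.induction with
  | empty => exact ⟨0, 0, by simp, by simp, by simp⟩
  | cons a S ih =>
    obtain ⟨P, L, rfl, hP, hL⟩ := ih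
    by_cases ha : f a ∈ L.map f
    · obtain ⟨b, hb, hab⟩ := Multiset.mem_map.1 ha
      obtain ⟨L', rfl⟩ := Multiset.exists_cons_of_mem hb
      refine ⟨(a, b) ::ₘ P, L', ?_, ?_, ?_⟩
      · rw [Multiset.map_cons, Multiset.sum_cons]
        simp only [Multiset.insert_eq_cons, ← Multiset.singleton_add]
        abel
      · intro q hq
        rcases Multiset.mem_cons.1 hq with rfl | hq
        · exact hab.symm
        · exact hP q hq
      · rw [Multiset.map_cons, Multiset.nodup_cons] at hL
        exact hL.2
    · refine ⟨P, a ::ₘ L, ?_, hP, ?_⟩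
      · simp only [← Multiset.singleton_add]
        abel
      · rw [Multiset.map_cons, Multiset.nodup_cons]
        exact ⟨ha, hL⟩

end Group

/-- The elements of `D_{2n} × C_2` whose dihedral component is a rotation. -/
def IsRot {n : ℕ} (g : DihedralTimesC2 n) : Prop := ∃ i, g.1 = DihedralGroup.r i

/-! ### Arithmetic of rotations and reflections -/

section Rotations

variable {n : ℕ} {a b x y : DihedralTimesC2 n}

theorem isRot_one : IsRot (1 : DihedralTimesC2 n) := ⟨0, rfl⟩

theorem isRot_mul_iff : IsRot (a * b) ↔ (IsRot a ↔ IsRot b) := by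
  obtain ⟨i | i, c⟩ := a <;> obtain ⟨j | j, d⟩ := b <;> simp [IsRot]

theorem IsRot.mul (ha : IsRot a) (hb : IsRot b) : IsRot (a * b) := by
  simp [isRot_mul_iff, ha, hb]

theorem IsRot.inv (ha : IsRot a) : IsRot a⁻¹ := by
  obtain ⟨i, hi⟩ := ha
  exact ⟨-i, by rw [Prod.fst_inv, hi]; rfl⟩

theorem isRot_mul_of_not (hx : ¬ IsRot x) (hy : ¬ IsRot y) : IsRot (x * y) := by
  simp [isRot_mul_iff, hx, hy]

theorem IsRot.mul_comm (ha : IsRot a) (hb : IsRot b) : a * b = b * a := by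
  obtain ⟨i | i, c⟩ := a <;> obtain ⟨j | j, d⟩ := b <;>
    simp_all [IsRot, _root_.mul_comm, add_comm]

theorem mul_self_eq_one (hx : ¬ IsRot x) : x * x = 1 := by
  obtain ⟨i | i, c⟩ := x
  · simp [IsRot] at hx
  · have : ∀ c : Multiplicative (ZMod 2), c * c = 1 := by decide
    simp [this]

theorem inv_eq_self (hx : ¬ IsRot x) : x⁻¹ = x := inv_eq_of_mul_eq_one_left (mul_self_eq_one hx)

theorem mul_eq_mul_inv (ha : IsRot a) (hx : ¬ IsRot x) : a * x = x * a⁻¹ := by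
  obtain ⟨i | i, c⟩ := a <;> obtain ⟨j | j, d⟩ := x
  · simp [IsRot] at hx
  · have : ∀ c : Multiplicative (ZMod 2), c⁻¹ = c := by decide
    simp [this, _root_.mul_comm, sub_eq_add_neg]
  · simp [IsRot] at hx
  · simp [IsRot] at ha

end Rotations

/-- Reduction of the rotation angle modulo a divisor. -/
def dihMap {n m : ℕ} (h : m ∣ n) : DihedralTimesC2 n →* DihedralTimesC2 m :=
  MonoidHom.prodMap
    { toFun := fun g => match g with
        | .r i => .r (ZMod.castHom h (ZMod m) i)
        | .sr i => .sr (ZMod.castHom h (ZMod m) i)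
      map_one' := congrArg DihedralGroup.r (map_zero _)
      map_mul' := by
        rintro (i | i) (j | j) <;> simp only [DihedralGroup.r_mul_r, DihedralGroup.r_mul_sr,
          DihedralGroup.sr_mul_r, DihedralGroup.sr_mul_sr, map_add, map_sub] }
    (MonoidHom.id _)

/-! ### The kernel of the reduction of angles -/

section Reduction

variable {n m : ℕ} (h : m ∣ n)

theorem isRot_dihMap (g : DihedralTimesC2 n) : IsRot (dihMap h g) ↔ IsRot g := by
  obtain ⟨i | i, c⟩ := g <;> simp [IsRot, dihMap]

theorem exists_zpow_of_dihMap_eq_one {g : DihedralTimesC2 n} (hg : dihMap h g = 1) :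
    ∃ j : ℤ, g = (DihedralGroup.r (m : ZMod n), 1) ^ j := by
  obtain ⟨i | i, c⟩ := g
  · have h1 : DihedralGroup.r (ZMod.castHom h (ZMod m) i) = DihedralGroup.r 0 :=
      congrArg Prod.fst hg
    have h2 : c = 1 := congrArg Prod.snd hg
    rw [DihedralGroup.r.injEq] at h1
    obtain ⟨k, rfl⟩ := ZMod.intCast_surjective i
    rw [map_intCast, ZMod.intCast_zmod_eq_zero_iff_dvd] at h1
    obtain ⟨j, rfl⟩ := h1
    refine ⟨j, ?_⟩
    rw [Prod.pow_mk, DihedralGroup.r_zpow, h2]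
    simp
  · have h1 : DihedralGroup.sr (ZMod.castHom h (ZMod m) i) = DihedralGroup.r 0 :=
      congrArg Prod.fst hg
    cases h1

theorem kernel_generator_pow (m p : ℕ) :
    ((DihedralGroup.r (m : ZMod (m * p)), 1) : DihedralTimesC2 (m * p)) ^ p = 1 := by
  rw [Prod.pow_mk, DihedralGroup.r_pow, ← Nat.cast_mul, ZMod.natCast_self]
  simp

end Reduction

/-- Every sequence of length at least `2n + 2` over `D_{2n} × C_2` has a product-one subsequence
of length `n`. -/
def HasEGZ (n : ℕ) : Prop :=
  ∀ S : Multiset (DihedralTimesC2 n), 2 * n + 2 ≤ S.card →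
    ∃ T ≤ S, IsProductOne T ∧ T.card = n

/-- Since 2np + 2 = (2n + 2) + (2p - 2)n, blocks of length n can be extracted 2p - 1 times, the last
one from the remaining 2n + 2 terms. -/
theorem HasEGZ.mul {n p : ℕ} (hn : HasEGZ n) (hp : 0 < p) : HasEGZ (n * p) := by
  intro S hS
  have hcard : 2 * n + 2 + (2 * p - 2) * n ≤ S.card := by
    obtain ⟨q, rfl⟩ := Nat.exists_eq_succ_of_ne_zero hp.ne'
    refine le_trans (le_of_eq ?_) hS
    rw [show 2 * q.succ - 2 = 2 * q by omega, Nat.succ_eq_add_one]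
    ring
  obtain ⟨𝓛, h1, h2, h3⟩ := exists_blocks (dihMap (Dvd.intro p rfl)) hn (2 * p - 2) S hcard
  obtain ⟨T, hT, hT1, hTc⟩ := exists_productOne_of_blocks (kernel_generator_pow n p) 𝓛
    (by omega) (fun l hl => ⟨(h3 l hl).1, exists_zpow_of_dihMap_eq_one _ (h3 l hl).2⟩)
  exact ⟨T, hT.trans h2, hT1, by rw [hTc, mul_comm]⟩

/-- The rotations obtained from `P` by distributing its terms over two ordered products that are
both rotations, and inverting the first product. -/
def signedSet {n : ℕ} (P : Multiset (DihedralTimesC2 n)) : Set (DihedralTimesC2 n) :=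
  {g | ∃ l₁ l₂ : List (DihedralTimesC2 n), (l₁ : Multiset (DihedralTimesC2 n)) + l₂ = P ∧
    IsRot l₁.prod ∧ IsRot l₂.prod ∧ g = l₁.prod⁻¹ * l₂.prod}

/-! ### Signed products of rotations -/

section Signed

variable {n : ℕ} {P P' : Multiset (DihedralTimesC2 n)} {a b x y g h : DihedralTimesC2 n}

theorem one_mem_signedSet : (1 : DihedralTimesC2 n) ∈ signedSet 0 :=
  ⟨[], [], by simp, isRot_one, isRot_one, by simp⟩

theorem mul_mem_signedSet (hg : g ∈ signedSet P) (hh : h ∈ signedSet P') :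
    g * h ∈ signedSet (P + P') := by
  obtain ⟨l₁, l₂, rfl, h1, h2, rfl⟩ := hg
  obtain ⟨k₁, k₂, rfl, h3, h4, rfl⟩ := hh
  refine ⟨l₁ ++ k₁, l₂ ++ k₂, ?_, ?_, ?_, ?_⟩
  · simp only [← Multiset.coe_add]; abel
  · rw [List.prod_append]; exact h1.mul h3
  · rw [List.prod_append]; exact h2.mul h4
  · rw [List.prod_append, List.prod_append, mul_inv_rev, h3.inv.mul_comm h1.inv, mul_assoc,
      mul_assoc, ← mul_assoc l₂.prod, h2.mul_comm h3.inv, mul_assoc]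

/-- Moving a rotation past a reflection inverts it, so the ordering x, l₁, y, l₂ has product x y
l₁⁻¹ l₂. -/
theorem mul_mem_productSet_of_signedSet (hy : ¬ IsRot y)
    (hg : g ∈ signedSet P) : x * y * g ∈ productSet ({x, y} + P) := by
  obtain ⟨l₁, l₂, rfl, h1, h2, rfl⟩ := hg
  refine ⟨x :: l₁ ++ y :: l₂, ?_, ?_⟩
  · rw [← Multiset.coe_add, ← Multiset.cons_coe, ← Multiset.cons_coe]
    simp only [Multiset.insert_eq_cons, ← Multiset.singleton_add]
    abel
  · rw [List.prod_append, List.prod_cons, List.prod_cons, mul_assoc, ← mul_assoc l₁.prod,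
      mul_eq_mul_inv h1 hy]
    simp only [mul_assoc]

theorem mem_signedSet_singleton (ha : IsRot a) : a ∈ signedSet {a} :=
  ⟨[], [a], by simp, isRot_one, by simpa using ha, by simp⟩

theorem inv_mem_signedSet_singleton (ha : IsRot a) : a⁻¹ ∈ signedSet {a} :=
  ⟨[a], [], by simp, by simpa using ha, isRot_one, by simp⟩

theorem mul_mem_signedSet_pair (ha : IsRot a) (hb : IsRot b) : a * b ∈ signedSet {a, b} :=
  mul_mem_signedSet (mem_signedSet_singleton ha) (mem_signedSet_singleton hb)

theorem inv_mul_mem_signedSet_pair (ha : IsRot a) (hb : IsRot b) : a⁻¹ * b ∈ signedSet {a, b} :=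
  mul_mem_signedSet (inv_mem_signedSet_singleton ha) (mem_signedSet_singleton hb)

theorem mul_inv_mem_signedSet_pair (ha : IsRot a) (hb : IsRot b) : a * b⁻¹ ∈ signedSet {a, b} :=
  mul_mem_signedSet (mem_signedSet_singleton ha) (inv_mem_signedSet_singleton hb)

theorem inv_mul_inv_mem_signedSet_pair (ha : IsRot a) (hb : IsRot b) :
    a⁻¹ * b⁻¹ ∈ signedSet {a, b} :=
  mul_mem_signedSet (inv_mem_signedSet_singleton ha) (inv_mem_signedSet_singleton hb)

theorem mul_mem_signedSet_refl (hx : ¬ IsRot x) (hy : ¬ IsRot y) : x * y ∈ signedSet {x, y} :=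
  ⟨[], [x, y], by simp [← Multiset.cons_coe], isRot_one, by simpa using isRot_mul_of_not hx hy, by simp⟩

theorem mul_swap_mem_signedSet_refl (hx : ¬ IsRot x) (hy : ¬ IsRot y) :
    y * x ∈ signedSet {x, y} := by
  rw [Multiset.pair_comm]
  exact mul_mem_signedSet_refl hy hx

end Signed

/-- The signed products of `P` contain at least `min p (w + 1)` powers of `z`. -/
def Wide {n : ℕ} (z : DihedralTimesC2 n) (p w : ℕ) (P : Multiset (DihedralTimesC2 n)) : Prop :=
  ∃ A : Finset (ZMod p), min p (w + 1) ≤ A.card ∧ ∀ a ∈ A, z ^ a.val ∈ signedSet P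

/-! ### Counting signed products with Cauchy–Davenport -/

section Wide

variable {n p : ℕ} {z : DihedralTimesC2 n} {P P' : Multiset (DihedralTimesC2 n)} {w w' : ℕ}

theorem wide_zero : Wide z p 0 0 :=
  ⟨{0}, by simp, by simp [one_mem_signedSet]⟩

theorem Wide.add [hp : Fact p.Prime] (hz : z ^ p = 1) (h : Wide z p w P) (h' : Wide z p w' P') :
    Wide z p (w + w') (P + P') := by
  obtain ⟨A, hA, hA'⟩ := h
  obtain ⟨B, hB, hB'⟩ := h'
  have hp0 := hp.out.pos
  have hAn : A.Nonempty := Finset.card_pos.1 (by omega)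
  have hBn : B.Nonempty := Finset.card_pos.1 (by omega)
  have hcd := ZMod.cauchy_davenport hp.out hAn hBn
  refine ⟨A + B, by omega, ?_⟩
  intro c hc
  obtain ⟨a, ha, b, hb, rfl⟩ := Finset.mem_add.1 hc
  rw [ZMod.val_add, ← pow_eq_pow_mod _ hz, pow_add]
  exact mul_mem_signedSet (hA' a ha) (hB' b hb)

theorem Wide.sum_map [Fact p.Prime] (hz : z ^ p = 1) {α : Type*}
    (f : α → Multiset (DihedralTimesC2 n)) (S : Multiset α) (h : ∀ a ∈ S, Wide z p 1 (f a)) :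
    Wide z p S.card (S.map f).sum := by
  induction S using Multiset.induction with
  | empty => exact wide_zero
  | cons a S ih =>
    rw [Multiset.map_cons, Multiset.sum_cons, Multiset.card_cons, add_comm]
    exact (h a (by simp)).add hz (ih fun b hb => h b (Multiset.mem_cons_of_mem hb))

theorem exists_pow_val_eq [Fact p.Prime] (hz : z ^ p = 1) (j : ℤ) :
    z ^ j = z ^ (j : ZMod p).val := by
  rw [← zpow_natCast, ZMod.val_intCast]
  conv_lhs => rw [← Int.emod_add_mul_ediv j p, zpow_add, zpow_mul, zpow_natCast, hz, one_zpow,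
    mul_one]

theorem wide_of_finset [Fact p.Prime] (hz : z ^ p = 1) (B : Finset (DihedralTimesC2 n))
    (hB : ∀ g ∈ B, g ∈ signedSet P ∧ ∃ j : ℤ, g = z ^ j) (hw : w + 1 ≤ B.card) :
    Wide z p w P := by
  classical
  let A : Finset (ZMod p) := Finset.univ.filter fun a => z ^ a.val ∈ B
  refine ⟨A, ?_, ?_⟩
  · have : B ⊆ A.image fun a => z ^ a.val := by
      intro g hg
      obtain ⟨j, rfl⟩ := (hB g hg).2
      rw [Finset.mem_image]
      refine ⟨j, ?_, (exists_pow_val_eq hz j).symm⟩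
      rw [Finset.mem_filter, ← exists_pow_val_eq hz j]
      exact ⟨Finset.mem_univ _, hg⟩
    have := (Finset.card_le_card this).trans Finset.card_image_le
    omega
  · intro a ha
    exact (hB _ (Finset.mem_filter.1 ha).2).1

/-- At least p - 1 of the p residues are attained, so two distinct ones cannot both be missed. -/
theorem Wide.mem_or_mem [Fact p.Prime] (hz : z ^ p = 1) (h : Wide z p w P) (hw : p ≤ w + 2)
    {i j : ℤ} (hij : z ^ i ≠ z ^ j) : z ^ i ∈ signedSet P ∨ z ^ j ∈ signedSet P := by
  classical
  obtain ⟨A, hA, hA'⟩ := h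
  rw [exists_pow_val_eq hz i, exists_pow_val_eq hz j] at *
  by_contra! hcon
  have hne : (i : ZMod p) ≠ j := fun h => hij (by rw [h])
  have hsub : A ⊆ (Finset.univ.erase (i : ZMod p)).erase (j : ZMod p) := by
    intro a ha
    rw [Finset.mem_erase, Finset.mem_erase]
    refine ⟨?_, ?_, Finset.mem_univ _⟩
    · rintro rfl; exact hcon.2 (hA' _ ha)
    · rintro rfl; exact hcon.1 (hA' _ ha)
  have h1 := Finset.card_le_card hsub
  rw [Finset.card_erase_of_mem (by simp [hne.symm]), Finset.card_erase_of_mem (by simp),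
    Finset.card_univ, ZMod.card] at h1
  have : 2 ≤ p := (Fact.out : p.Prime).two_le
  omega

theorem Wide.mem [Fact p.Prime] (hz : z ^ p = 1) (h : Wide z p w P) (hw : p ≤ w + 1)
    (j : ℤ) : z ^ j ∈ signedSet P := by
  obtain ⟨A, hA, hA'⟩ := h
  rw [exists_pow_val_eq hz j]
  have : A = Finset.univ := by
    rw [← Finset.card_eq_iff_eq_univ, ZMod.card]
    have := A.card_le_univ
    rw [ZMod.card] at this
    omega
  exact hA' _ (this ▸ Finset.mem_univ _)

end Wide

instance decidablePredIsRot {n : ℕ} : DecidablePred (IsRot (n := n))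
  | (.r i, _) => isTrue ⟨i, rfl⟩
  | (.sr _, _) => isFalse fun ⟨_, h⟩ => by cases h

/-- The reduction of `D_{4p} × C_2` to the elementary abelian group `D_4 × C_2`. -/
abbrev cls {p : ℕ} : DihedralTimesC2 (2 * p) →* DihedralTimesC2 2 := dihMap (Dvd.intro p rfl)

/-- A generator of the kernel of `cls`. -/
abbrev gen (p : ℕ) : DihedralTimesC2 (2 * p) := (DihedralGroup.r ((2 : ℕ) : ZMod (2 * p)), 1)

theorem mul_self_elementary (v : DihedralTimesC2 2) : v * v = 1 := by
  revert v; decide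

theorem inv_elementary (v : DihedralTimesC2 2) : v⁻¹ = v :=
  inv_eq_of_mul_eq_one_left (mul_self_elementary v)

theorem mul_comm_elementary (v w : DihedralTimesC2 2) : v * w = w * v := by
  revert v w; decide

theorem zpow_eq_one_of_mul_self {G : Type*} [Group G] {z : G} {p : ℕ} {j : ℤ} (hodd : Odd p)
    (hz : z ^ p = 1) (h : z ^ j * z ^ j = 1) : z ^ j = 1 := by
  obtain ⟨k, rfl⟩ := hodd
  have h1 : (z ^ j) ^ (2 * k + 1) = 1 := by
    rw [← zpow_natCast, ← zpow_mul, mul_comm j, zpow_mul, zpow_natCast, hz, one_zpow]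
  rwa [pow_succ, pow_mul, pow_two, h, one_pow, one_mul] at h1

/-! ### Pairs of equal class and quadruples with product in the kernel -/

section Pairs

variable {p : ℕ} {a b u v x y : DihedralTimesC2 (2 * p)}

theorem isRot_congr (h : cls a = cls b) : IsRot a ↔ IsRot b := by
  rw [← isRot_dihMap (Dvd.intro p rfl) a, ← isRot_dihMap (Dvd.intro p rfl) b]
  exact Eq.to_iff (congrArg IsRot h)

theorem productOne_of_quad_of_inv_mem {g : DihedralTimesC2 (2 * p)}
    {P Q : Multiset (DihedralTimesC2 (2 * p))} (hy : ¬ IsRot y) (hg : g ∈ signedSet Q)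
    (h : (x * y * g)⁻¹ ∈ signedSet P) :
    IsProductOne ({x, y} + (Q + P)) := by
  have := mul_mem_productSet_of_signedSet (x := x) hy (mul_mem_signedSet hg h)
  rwa [← mul_assoc, mul_inv_cancel] at this

theorem gen_pow (p : ℕ) : gen p ^ p = 1 := kernel_generator_pow 2 p

theorem eq_one_of_mul_self {g : DihedralTimesC2 (2 * p)} (hodd : Odd p) (hg : cls g = 1)
    (h : g * g = 1) : g = 1 := by
  obtain ⟨j, rfl⟩ := exists_zpow_of_dihMap_eq_one _ hg
  exact zpow_eq_one_of_mul_self hodd (gen_pow p) h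

/-- Two rotations and two reflections whose product lies in the kernel of `cls`. -/
structure IsQuad (u v x y : DihedralTimesC2 (2 * p)) : Prop where
  rot_left : IsRot u
  rot_right : IsRot v
  refl_left : ¬ IsRot x
  refl_right : ¬ IsRot y
  cls_eq_one : cls (x * y * (u * v)) = 1

/-- The product is a product of commuting rotations with trivial squares, hence squares to 1; the
kernel has odd order, so it is 1. -/
theorem IsQuad.productOne (hodd : Odd p) (hQ : IsQuad u v x y) (hu : u * u = 1) (hv : v * v = 1)
    (hxy : x * y * (x * y) = 1) : IsProductOne ({x, y} + {u, v}) := by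
  have h1 : x * y * (u * v) = 1 := by
    have huv := hQ.rot_left.mul hQ.rot_right
    have hxy' := isRot_mul_of_not hQ.refl_left hQ.refl_right
    refine eq_one_of_mul_self hodd hQ.cls_eq_one ?_
    nth_rw 1 [hxy'.mul_comm huv]
    rw [mul_assoc, ← mul_assoc (x * y), hxy, one_mul]
    nth_rw 1 [hQ.rot_left.mul_comm hQ.rot_right]
    rw [mul_assoc, ← mul_assoc u, hu, one_mul, hv]
  have := mul_mem_productSet_of_signedSet (x := x) hQ.refl_right
    (mul_mem_signedSet_pair hQ.rot_left hQ.rot_right)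
  rwa [h1] at this

variable [hp : Fact p.Prime]

/-- Among the four signed products, changing one sign always changes the value. If both coincidences
under changing two signs occurred, odd order would force a b = 1 and a = b, hence a a = 1. So at
least three values are distinct. -/
theorem wide_two_of_rot (hodd : Odd p) (ha : IsRot a) (hb : IsRot b) (hab : cls a = cls b)
    (ha1 : a * a ≠ 1) (hb1 : b * b ≠ 1) : Wide (gen p) p 2 {a, b} := by
  classical
  have hk : ∀ g ∈ signedSet {a, b}, cls g = 1 → g ∈ signedSet {a, b} ∧ ∃ j : ℤ, g = gen p ^ j :=
    fun g hg h => ⟨hg, exists_zpow_of_dihMap_eq_one _ h⟩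
  have c1 := hk _ (mul_mem_signedSet_pair ha hb) (by rw [map_mul, hab, mul_self_elementary])
  have c2 := hk _ (mul_inv_mem_signedSet_pair ha hb)
    (by rw [map_mul, map_inv, inv_elementary, hab, mul_self_elementary])
  have c3 := hk _ (inv_mul_mem_signedSet_pair ha hb)
    (by rw [map_mul, map_inv, inv_elementary, hab, mul_self_elementary])
  have c4 := hk _ (inv_mul_inv_mem_signedSet_pair ha hb)
    (by rw [map_mul, map_inv, map_inv, inv_elementary, inv_elementary, hab, mul_self_elementary])
  have e1 : a * b ≠ a * b⁻¹ := fun h => hb1 (by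
    nth_rw 1 [mul_left_cancel h]; simp)
  have e2 : a * b ≠ a⁻¹ * b := fun h => ha1 (by
    nth_rw 1 [mul_right_cancel h]; simp)
  have e3 : a⁻¹ * b⁻¹ ≠ a * b⁻¹ := fun h => ha1 (by
    nth_rw 1 [← mul_right_cancel h]; simp)
  by_cases hc : a * b = a⁻¹ * b⁻¹
  · have h1 : a * b = 1 := by
      refine eq_one_of_mul_self hodd (by rw [map_mul, hab, mul_self_elementary]) ?_
      nth_rw 1 [hc]
      rw [ha.inv.mul_comm hb.inv]
      group
    have e4 : a * b⁻¹ ≠ a⁻¹ * b := by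
      intro h
      have h2 : a * b⁻¹ = 1 := by
        refine eq_one_of_mul_self hodd
          (by rw [map_mul, map_inv, inv_elementary, hab, mul_self_elementary]) ?_
        nth_rw 1 [h]
        rw [ha.mul_comm hb.inv]
        group
      rw [mul_inv_eq_one] at h2
      exact ha1 (by rw [← h2] at h1; exact h1)
    refine wide_of_finset (gen_pow p) {a * b, a * b⁻¹, a⁻¹ * b} ?_ ?_
    · intro g hg
      simp only [Finset.mem_insert, Finset.mem_singleton] at hg
      rcases hg with rfl | rfl | rfl <;> assumption
    · rw [Finset.card_eq_three.2 ⟨_, _, _, e1, e2, e4, rfl⟩]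
  · refine wide_of_finset (gen_pow p) {a * b, a * b⁻¹, a⁻¹ * b⁻¹} ?_ ?_
    · intro g hg
      simp only [Finset.mem_insert, Finset.mem_singleton] at hg
      rcases hg with rfl | rfl | rfl <;> assumption
    · rw [Finset.card_eq_three.2 ⟨_, _, _, e1, hc, e3.symm, rfl⟩]

theorem wide_one_of_ne {P : Multiset (DihedralTimesC2 (2 * p))} {g h : DihedralTimesC2 (2 * p)}
    (hg : g ∈ signedSet P) (hh : h ∈ signedSet P) (hg1 : cls g = 1) (hh1 : cls h = 1)
    (hgh : g ≠ h) : Wide (gen p) p 1 P := by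
  classical
  refine wide_of_finset (gen_pow p) {g, h} ?_ (by rw [Finset.card_pair hgh])
  intro k hk
  simp only [Finset.mem_insert, Finset.mem_singleton] at hk
  rcases hk with rfl | rfl
  · exact ⟨hg, exists_zpow_of_dihMap_eq_one _ hg1⟩
  · exact ⟨hh, exists_zpow_of_dihMap_eq_one _ hh1⟩

/-- Pairs of equal involutions (or of identities). -/
def IsTrivialPair (q : DihedralTimesC2 (2 * p) × DihedralTimesC2 (2 * p)) : Prop :=
  q.1 = q.2 ∧ q.1 * q.1 = 1

/-- For rotations, inverting a term that is not its own inverse gives a second value. For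
reflections, x y and y x are mutually inverse and agree only if x = y, by odd order. -/
theorem wide_one_of_pair (hodd : Odd p)
    {q : DihedralTimesC2 (2 * p) × DihedralTimesC2 (2 * p)} (hq : cls q.1 = cls q.2)
    (hnt : ¬ IsTrivialPair q) : Wide (gen p) p 1 {q.1, q.2} := by
  obtain ⟨a, b⟩ := q
  have c1 : cls (a * b) = 1 := by rw [map_mul, hq, mul_self_elementary]
  by_cases ha : IsRot a
  · have hb : IsRot b := (isRot_congr hq).1 ha
    by_cases hb1 : b * b = 1
    · by_cases ha1 : a * a = 1
      · refine absurd ⟨?_, ha1⟩ hnt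
        have : a * b = 1 := by
          refine eq_one_of_mul_self hodd c1 ?_
          nth_rw 1 [ha.mul_comm hb]
          rw [mul_assoc, ← mul_assoc a, ha1, one_mul, hb1]
        rw [eq_inv_of_mul_eq_one_left this]
        exact inv_eq_of_mul_eq_one_left hb1
      · refine wide_one_of_ne (mul_mem_signedSet_pair ha hb) (inv_mul_mem_signedSet_pair ha hb) c1
          (by rw [map_mul, map_inv, inv_elementary, hq, mul_self_elementary]) fun h => ha1 ?_
        change a * b = a⁻¹ * b at h
        nth_rw 1 [mul_right_cancel h]; simp
    · refine wide_one_of_ne (mul_mem_signedSet_pair ha hb) (mul_inv_mem_signedSet_pair ha hb) c1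
        (by rw [map_mul, map_inv, inv_elementary, hq, mul_self_elementary]) fun h => hb1 ?_
      change a * b = a * b⁻¹ at h
      nth_rw 1 [mul_left_cancel h]; simp
  · have hb : ¬ IsRot b := fun h => ha ((isRot_congr hq).2 h)
    refine wide_one_of_ne (mul_mem_signedSet_refl ha hb) (mul_swap_mem_signedSet_refl ha hb) c1
      (by rw [map_mul, hq, mul_self_elementary]) fun h => hnt ⟨?_, mul_self_eq_one ha⟩
    have : a * b = 1 := by
      refine eq_one_of_mul_self hodd c1 ?_
      nth_rw 1 [h]
      rw [mul_assoc, ← mul_assoc a, mul_self_eq_one ha, one_mul, mul_self_eq_one hb]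
    rw [eq_inv_of_mul_eq_one_left this, inv_eq_self hb]

variable {P : Multiset (DihedralTimesC2 (2 * p))} {w : ℕ}

theorem IsQuad.productOne_of_wide (hQ : IsQuad u v x y) (hP : Wide (gen p) p w P)
    (hw : p ≤ w + 1) : IsProductOne ({x, y} + ({u, v} + P)) := by
  refine productOne_of_quad_of_inv_mem hQ.refl_right
    (mul_mem_signedSet_pair hQ.rot_left hQ.rot_right) ?_
  obtain ⟨j, hj⟩ := exists_zpow_of_dihMap_eq_one _ hQ.cls_eq_one
  rw [hj, ← zpow_neg]
  exact hP.mem (gen_pow p) hw _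

theorem Wide.inv_mem_or {g h : DihedralTimesC2 (2 * p)} (hP : Wide (gen p) p w P)
    (hw : p ≤ w + 2) (hg : cls g = 1) (hh : cls h = 1) (hgh : g ≠ h) :
    g⁻¹ ∈ signedSet P ∨ h⁻¹ ∈ signedSet P := by
  obtain ⟨i, rfl⟩ := exists_zpow_of_dihMap_eq_one _ hg
  obtain ⟨j, rfl⟩ := exists_zpow_of_dihMap_eq_one _ hh
  rw [← zpow_neg, ← zpow_neg]
  refine hP.mem_or_mem (gen_pow p) hw fun h => hgh ?_
  rwa [zpow_neg, zpow_neg, inv_inj] at h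

/-- Inverting u, inverting v or exchanging x and y gives the quadruple a second kernel value. The
signed products of P miss at most one kernel element, so one of the two values can be cancelled. -/
theorem IsQuad.productOne_of_ne (hQ : IsQuad u v x y) (hP : Wide (gen p) p w P)
    (hw : p ≤ w + 2) (hne : u * u ≠ 1 ∨ v * v ≠ 1 ∨ x * y * (x * y) ≠ 1) :
    IsProductOne ({x, y} + ({u, v} + P)) := by
  obtain ⟨hu, hv, hx, hy, h1⟩ := hQ
  have huv := mul_mem_signedSet_pair hu hv
  rcases hne with h | h | h
  · rcases hP.inv_mem_or hw h1 (h := x * y * (u⁻¹ * v))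
      (by simpa [map_mul, map_inv, inv_elementary] using h1)
      (fun e => h (by nth_rw 1 [mul_right_cancel (mul_left_cancel e)]; simp)) with h2 | h2
    · exact productOne_of_quad_of_inv_mem hy huv h2
    · exact productOne_of_quad_of_inv_mem hy (inv_mul_mem_signedSet_pair hu hv) h2
  · rcases hP.inv_mem_or hw h1 (h := x * y * (u * v⁻¹))
      (by simpa [map_mul, map_inv, inv_elementary] using h1)
      (fun e => h (by nth_rw 1 [mul_left_cancel (mul_left_cancel e)]; simp)) with h2 | h2
    · exact productOne_of_quad_of_inv_mem hy huv h2
    · exact productOne_of_quad_of_inv_mem hy (mul_inv_mem_signedSet_pair hu hv) h2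
  · rcases hP.inv_mem_or hw h1 (h := y * x * (u * v))
      (by rw [map_mul, map_mul cls y, mul_comm_elementary (cls y), ← map_mul, ← map_mul, h1])
      (fun e => h (by
        nth_rw 1 [mul_right_cancel e]
        rw [mul_assoc, ← mul_assoc x, mul_self_eq_one hx, one_mul, mul_self_eq_one hy]))
      with h2 | h2
    · exact productOne_of_quad_of_inv_mem hy huv h2
    · rw [Multiset.pair_comm]
      exact productOne_of_quad_of_inv_mem hx huv h2

end Pairs

/-- The two terms of a pair, as a sequence. -/
abbrev pairSeq {α : Type*} (q : α × α) : Multiset α := {q.1, q.2}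

theorem card_sum_pairSeq {α : Type*} (M : Multiset (α × α)) :
    (M.map pairSeq).sum.card = M.card * 2 :=
  card_sum_map _ 2 M fun _ _ => by simp

theorem card_le_four_of_nodup_of_isRot (s : Multiset (DihedralTimesC2 2)) (hs : s.Nodup)
    (h : ∀ g ∈ s, IsRot g) : s.card ≤ 4 := by
  have h1 : (⟨s, hs⟩ : Finset (DihedralTimesC2 2)) ⊆ Finset.univ.filter IsRot := fun g hg =>
    Finset.mem_filter.2 ⟨Finset.mem_univ _, h g hg⟩
  have h2 : (Finset.univ.filter (IsRot (n := 2))).card = 4 := by decide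
  exact h2 ▸ Finset.card_le_card h1

/-! ### Odd p: completing a quadruple by pairs -/

section OddPrime

variable {p : ℕ} {u v x y : DihedralTimesC2 (2 * p)}
  {M : Multiset (DihedralTimesC2 (2 * p) × DihedralTimesC2 (2 * p))}

theorem exists_of_trivial_pairs {k : ℕ} (hM : ∀ q ∈ M, IsTrivialPair q) (hk : k ≤ M.card) :
    ∃ T ≤ (M.map pairSeq).sum, IsProductOne T ∧ T.card = k * 2 := by
  obtain ⟨M', hM', rfl⟩ := exists_le_card M k hk
  refine ⟨_, sum_map_le_sum_map _ hM', IsProductOne.sum_map _ _ fun q hq => ?_,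
    card_sum_pairSeq M'⟩
  obtain ⟨h1, h2⟩ := hM q (Multiset.mem_of_le hM' hq)
  exact ⟨[q.1, q.2], rfl, by simp [← h1, h2]⟩

variable [hp : Fact p.Prime]

theorem wide_of_pairs (hodd : Odd p) (hM : ∀ q ∈ M, cls q.1 = cls q.2 ∧ ¬ IsTrivialPair q) :
    Wide (gen p) p M.card (M.map pairSeq).sum :=
  Wide.sum_map (gen_pow p) _ _ fun q hq => wide_one_of_pair hodd (hM q hq).1 (hM q hq).2

theorem exists_of_quad_of_ne (hodd : Odd p) (hQ : IsQuad u v x y)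
    (hne : u * u ≠ 1 ∨ v * v ≠ 1 ∨ x * y * (x * y) ≠ 1)
    (hM : ∀ q ∈ M, cls q.1 = cls q.2 ∧ ¬ IsTrivialPair q) (hcard : p - 2 ≤ M.card) :
    ∃ T ≤ {x, y} + ({u, v} + (M.map pairSeq).sum), IsProductOne T ∧ T.card = 2 * p := by
  have := hp.out.two_le
  obtain ⟨M', hM', hM'c⟩ := exists_le_card M _ hcard
  refine ⟨{x, y} + ({u, v} + (M'.map pairSeq).sum), ?_, ?_, ?_⟩
  · gcongr
    exact sum_map_le_sum_map _ hM'
  · exact hQ.productOne_of_ne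
      (wide_of_pairs hodd fun q hq => hM q (Multiset.mem_of_le hM' hq)) (by omega) hne
  · simp only [Multiset.card_add, Multiset.card_pair, card_sum_pairSeq]
    omega

/-- The pair of width 2 saves one pair: the width is 2 + (p - 3) = p - 1, enough for the whole
kernel, and the length is 4 + 2 + 2(p - 3) = 2p. -/
theorem exists_of_quad_of_wide_two (hodd : Odd p) (hQ : IsQuad u v x y)
    {a b : DihedralTimesC2 (2 * p)} (hab : Wide (gen p) p 2 {a, b})
    (hM : ∀ q ∈ M, cls q.1 = cls q.2 ∧ ¬ IsTrivialPair q) (hcard : p - 3 ≤ M.card) :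
    ∃ T ≤ {x, y} + ({u, v} + ({a, b} + (M.map pairSeq).sum)),
      IsProductOne T ∧ T.card = 2 * p := by
  have := hp.out.two_le
  have h3 : 3 ≤ p := by obtain ⟨k, hk⟩ := hodd; omega
  obtain ⟨M', hM', hM'c⟩ := exists_le_card M _ hcard
  refine ⟨{x, y} + ({u, v} + ({a, b} + (M'.map pairSeq).sum)), ?_, ?_, ?_⟩
  · gcongr
    exact sum_map_le_sum_map _ hM'
  · exact hQ.productOne_of_wide (hab.add (gen_pow p)
      (wide_of_pairs hodd fun q hq => hM q (Multiset.mem_of_le hM' hq))) (by omega)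
  · simp only [Multiset.card_add, Multiset.card_pair, card_sum_pairSeq]
    omega

theorem exists_of_refl_pair (hodd : Odd p) (hy : ¬ IsRot y)
    (hxy : cls x = cls y) (hM : ∀ q ∈ M, cls q.1 = cls q.2 ∧ ¬ IsTrivialPair q)
    (hcard : p - 1 ≤ M.card) :
    ∃ T ≤ {x, y} + (M.map pairSeq).sum, IsProductOne T ∧ T.card = 2 * p := by
  have := hp.out.two_le
  obtain ⟨M', hM', hM'c⟩ := exists_le_card M _ hcard
  refine ⟨{x, y} + (M'.map pairSeq).sum, ?_, ?_, ?_⟩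
  · gcongr
    exact sum_map_le_sum_map _ hM'
  · obtain ⟨j, hj⟩ := exists_zpow_of_dihMap_eq_one (Dvd.intro p rfl)
      (show cls (x * y) = 1 by rw [map_mul, hxy, mul_self_elementary])
    have h1 := (wide_of_pairs hodd fun q hq => hM q (Multiset.mem_of_le hM' hq)).mem
      (gen_pow p) (by omega) (-j)
    have h2 := mul_mem_productSet_of_signedSet (x := x) hy h1
    rw [hj, zpow_neg, mul_inv_cancel] at h2
    exact h2
  · simp only [Multiset.card_add, Multiset.card_pair, card_sum_pairSeq]
    omega

/-- Either some pair of width 2 is available, or a non-involutive rotation can replace u or v.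
Pigeonhole over the four rotation classes shows that one of these occurs. -/
theorem exists_of_rot_pairs (hodd : Odd p) (hQ : IsQuad u v x y) (huv : cls u ≠ cls v)
    (hM : ∀ q ∈ M, cls q.1 = cls q.2 ∧ ¬ IsTrivialPair q) (hrot : ∀ q ∈ M, IsRot q.1)
    (hcard : p ≤ M.card) :
    ∃ T ≤ {x, y} + ({u, v} + (M.map pairSeq).sum), IsProductOne T ∧ T.card = 2 * p := by
  have h3 : 3 ≤ p := by have := hp.out.two_le; obtain ⟨k, hk⟩ := hodd; omega
  by_cases hall : ∃ q ∈ M, q.1 * q.1 ≠ 1 ∧ q.2 * q.2 ≠ 1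
  · obtain ⟨q, hq, h1, h2⟩ := hall
    obtain ⟨M', rfl⟩ := Multiset.exists_cons_of_mem hq
    rw [Multiset.map_cons, Multiset.sum_cons]
    rw [Multiset.card_cons] at hcard
    exact exists_of_quad_of_wide_two hodd hQ (wide_two_of_rot hodd (hrot q hq)
      ((isRot_congr (hM q hq).1).1 (hrot q hq)) (hM q hq).1 h1 h2)
      (fun q' hq' => hM q' (Multiset.mem_cons_of_mem hq')) (by omega)
  -- Two rotations of equal class with trivial squares coincide by odd order, so a nontrivial pair
  -- has a term j with j j ≠ 1.
  have hsplit : ∀ q ∈ M, ∃ j k, pairSeq q = {j} + {k} ∧ j * j ≠ 1 ∧ cls j = cls q.1 := by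
    intro q hq
    by_cases h1 : q.1 * q.1 = 1
    · by_cases h2 : q.2 * q.2 = 1
      · exfalso
        refine (hM q hq).2 ⟨?_, h1⟩
        have hr := hrot q hq
        have hr2 := (isRot_congr (hM q hq).1).1 hr
        have : q.1 * q.2 = 1 := by
          refine eq_one_of_mul_self hodd (by rw [map_mul, (hM q hq).1, mul_self_elementary]) ?_
          nth_rw 1 [hr.mul_comm hr2]
          rw [mul_assoc, ← mul_assoc q.1, h1, one_mul, h2]
        rw [eq_inv_of_mul_eq_one_left this]
        exact inv_eq_of_mul_eq_one_left h2
      · exact ⟨q.2, q.1, Multiset.pair_comm _ _, h2, (hM q hq).1.symm⟩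
    · exact ⟨q.1, q.2, rfl, h1, rfl⟩
  -- A pair in the class of u lends its term j to replace u; the new quadruple has a second value,
  -- and the p - 1 remaining pairs are enough.
  have hswap : ∀ u v, IsQuad u v x y → ∀ q ∈ M, cls q.1 = cls u →
      ∃ T ≤ {x, y} + ({u, v} + (M.map pairSeq).sum), IsProductOne T ∧ T.card = 2 * p := by
    intro u v hQ q hq hqu
    obtain ⟨j, k, h1, h2, h4⟩ := hsplit q hq
    obtain ⟨M', rfl⟩ := Multiset.exists_cons_of_mem hq
    rw [Multiset.card_cons] at hcard
    have hju : cls j = cls u := h4.trans hqu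
    have hQ' : IsQuad j v x y := by
      refine ⟨(isRot_congr hju).2 hQ.rot_left, hQ.rot_right, hQ.refl_left, hQ.refl_right, ?_⟩
      have := hQ.cls_eq_one
      rwa [map_mul, map_mul cls u, ← hju, ← map_mul, ← map_mul] at this
    obtain ⟨T, hT, hT'⟩ := exists_of_quad_of_ne (M := M') hodd hQ' (Or.inl h2)
      (fun q' hq' => hM q' (Multiset.mem_cons_of_mem hq')) (by omega)
    refine ⟨T, hT.trans ?_, hT'⟩
    rw [Multiset.map_cons, Multiset.sum_cons, h1]
    refine add_le_add le_rfl ?_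
    simp only [Multiset.insert_eq_cons, ← Multiset.singleton_add]
    refine le_trans (Multiset.le_add_left _ ({u} + {k})) (le_of_eq ?_)
    abel
  by_cases hu : cls u ∈ M.map fun q => cls q.1
  · obtain ⟨q, hq, h⟩ := Multiset.mem_map.1 hu
    exact hswap u v hQ q hq h
  by_cases hv : cls v ∈ M.map fun q => cls q.1
  · obtain ⟨q, hq, h⟩ := Multiset.mem_map.1 hv
    rw [Multiset.pair_comm u v]
    refine hswap v u ⟨hQ.rot_right, hQ.rot_left, hQ.refl_left, hQ.refl_right, ?_⟩ q hq h
    rw [hQ.rot_right.mul_comm hQ.rot_left]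
    exact hQ.cls_eq_one
  -- Only two rotation classes remain for p ≥ 3 pairs, so two pairs share a class and their terms
  -- j₁, j₂ form a pair of width 2.
  by_cases hnd : (M.map fun q => cls q.1).Nodup
  · exfalso
    have h4 := card_le_four_of_nodup_of_isRot (cls u ::ₘ cls v ::ₘ M.map fun q => cls q.1)
      (by simp only [Multiset.nodup_cons, Multiset.mem_cons, not_or]; exact ⟨⟨huv, hu⟩, hv, hnd⟩)
      (by
        intro g hg
        simp only [Multiset.mem_cons, Multiset.mem_map] at hg
        rcases hg with rfl | rfl | ⟨q, hq, rfl⟩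
        · exact (isRot_dihMap _ _).2 hQ.rot_left
        · exact (isRot_dihMap _ _).2 hQ.rot_right
        · exact (isRot_dihMap _ _).2 (hrot q hq))
    simp only [Multiset.card_cons, Multiset.card_map] at h4
    omega
  · rw [Multiset.nodup_iff_le] at hnd
    push Not at hnd
    obtain ⟨c, hc⟩ := hnd
    obtain ⟨D, hD, hDc⟩ := exists_le_map_eq _ _ _ hc
    have hD2 : D.card = 2 := by simpa using congrArg Multiset.card hDc
    obtain ⟨q₁, q₂, rfl⟩ := Multiset.card_eq_two.1 hD2
    have hcls : ∀ q ∈ ({q₁, q₂} : Multiset (DihedralTimesC2 (2 * p) × DihedralTimesC2 (2 * p))),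
        cls q.1 = c := by
      intro q hq
      have := Multiset.mem_map_of_mem (fun q => cls q.1) hq
      rw [hDc] at this
      simpa using this
    obtain ⟨M', rfl⟩ := Multiset.le_iff_exists_add.1 hD
    rw [Multiset.card_add, hD2] at hcard
    obtain ⟨j₁, k₁, h1, h2, h4⟩ := hsplit q₁ (by simp)
    obtain ⟨j₂, k₂, h5, h6, h8⟩ := hsplit q₂ (by simp)
    have e1 : cls j₁ = c := h4.trans (hcls q₁ (by simp))
    have e2 : cls j₂ = c := h8.trans (hcls q₂ (by simp))
    have r1 : IsRot j₁ := (isRot_congr h4).2 (hrot q₁ (by simp))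
    have r2 : IsRot j₂ := (isRot_congr h8).2 (hrot q₂ (by simp))
    obtain ⟨T, hT, hT'⟩ := exists_of_quad_of_wide_two (M := M') hodd hQ
      (wide_two_of_rot hodd r1 r2 (e1.trans e2.symm) h2 h6)
      (fun q' hq' => hM q' (Multiset.mem_add.2 (Or.inr hq'))) (by omega)
    refine ⟨T, hT.trans ?_, hT'⟩
    have : (Multiset.map pairSeq ({q₁, q₂} + M')).sum
        = pairSeq q₁ + pairSeq q₂ + (M'.map pairSeq).sum := by
      rw [Multiset.map_add, Multiset.sum_add]
      exact congrArg (· + _) (Multiset.sum_pair _ _)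
    rw [this, h1, h5]
    refine add_le_add le_rfl (add_le_add le_rfl ?_)
    simp only [Multiset.insert_eq_cons, ← Multiset.singleton_add]
    refine le_trans (Multiset.le_add_left _ ({k₁} + {k₂})) (le_of_eq ?_)
    abel

/-- There are at least 2p - 3 pairs, split into trivial ones Z and nontrivial ones N. Many pairs in
Z give padding, while few leave enough in N to reach the whole kernel. -/
theorem exists_of_pairs_of_quad (hodd : Odd p) (hQ : IsQuad u v x y) (huv : cls u ≠ cls v)
    (hM : ∀ q ∈ M, cls q.1 = cls q.2) (hcard : 2 * p ≤ M.card + 3) :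
    ∃ T ≤ {x, y} + ({u, v} + (M.map pairSeq).sum), IsProductOne T ∧ T.card = 2 * p := by
  classical
  have h3 : 3 ≤ p := by have := hp.out.two_le; obtain ⟨k, hk⟩ := hodd; omega
  set Z := M.filter IsTrivialPair with hZ
  set N := M.filter fun q => ¬ IsTrivialPair q with hN
  have hZN : Z + N = M := Multiset.filter_add_not _ _
  have hZt : ∀ q ∈ Z, IsTrivialPair q := fun q hq => (Multiset.mem_filter.1 hq).2
  have hNt : ∀ q ∈ N, cls q.1 = cls q.2 ∧ ¬ IsTrivialPair q := fun q hq =>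
    ⟨hM q (Multiset.mem_filter.1 hq).1, (Multiset.mem_filter.1 hq).2⟩
  have hZle : (Z.map pairSeq).sum ≤ (M.map pairSeq).sum :=
    sum_map_le_sum_map _ (Multiset.filter_le _ _)
  have hNle : (N.map pairSeq).sum ≤ (M.map pairSeq).sum :=
    sum_map_le_sum_map _ (Multiset.filter_le _ _)
  have hc : Z.card + N.card = M.card := by rw [← Multiset.card_add, hZN]
  by_cases hZp : p ≤ Z.card
  · obtain ⟨T, hT, hT1, hTc⟩ := exists_of_trivial_pairs hZt hZp
    refine ⟨T, ?_, hT1, by omega⟩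
    exact (hT.trans hZle).trans ((Multiset.le_add_left _ _).trans (Multiset.le_add_left _ _))
  -- Here |Z| ≤ p - 1, so |N| ≥ p - 2.
  by_cases hne : u * u ≠ 1 ∨ v * v ≠ 1 ∨ x * y * (x * y) ≠ 1
  · obtain ⟨T, hT, hT'⟩ := exists_of_quad_of_ne hodd hQ hne hNt (by omega)
    exact ⟨T, hT.trans (by gcongr), hT'⟩
  push Not at hne
  -- The quadruple is now itself product-one, and p - 2 trivial pairs fill it up to length 2p.
  by_cases hZp2 : p - 2 ≤ Z.card
  · obtain ⟨T, hT, hT1, hTc⟩ := exists_of_trivial_pairs hZt hZp2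
    refine ⟨{x, y} + ({u, v} + T), by gcongr; exact hT.trans hZle, ?_, ?_⟩
    · rw [← add_assoc]
      exact (hQ.productOne hodd hne.1 hne.2.1 hne.2.2).add hT1
    · simp only [Multiset.card_add, Multiset.card_pair, hTc]
      omega
  -- Now |Z| ≤ p - 3 and |N| ≥ p. A pair of reflections, trivial or not, can play the role of x, y,
  -- with p - 1 other nontrivial pairs.
  by_cases hrefl : ∃ q ∈ M, ¬ IsRot q.1
  · obtain ⟨q, hq, hqr⟩ := hrefl
    have hqr2 : ¬ IsRot q.2 := fun h => hqr ((isRot_congr (hM q hq)).2 h)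
    obtain ⟨M', hM'⟩ := Multiset.exists_cons_of_mem hq
    have hcN : p - 1 ≤ (M'.filter fun q => ¬ IsTrivialPair q).card := by
      have : N ≤ q ::ₘ M'.filter fun q => ¬ IsTrivialPair q := by
        rw [hN, hM', Multiset.filter_cons, ← Multiset.singleton_add]
        gcongr
        split_ifs <;> simp
      have := Multiset.card_le_card this
      rw [Multiset.card_cons] at this
      omega
    obtain ⟨T, hT, hT'⟩ := exists_of_refl_pair hodd hqr2 (hM q hq)
      (M := M'.filter fun q => ¬ IsTrivialPair q)
      (fun q' hq' => ⟨hM q' (hM' ▸ Multiset.mem_cons_of_mem (Multiset.mem_filter.1 hq').1),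
        (Multiset.mem_filter.1 hq').2⟩) hcN
    refine ⟨T, hT.trans ?_, hT'⟩
    refine le_trans ?_ ((Multiset.le_add_left _ _).trans (Multiset.le_add_left _ _))
    rw [hM', Multiset.map_cons, Multiset.sum_cons]
    gcongr
    exact sum_map_le_sum_map _ (Multiset.filter_le _ _)
  · push Not at hrefl
    obtain ⟨T, hT, hT'⟩ := exists_of_rot_pairs hodd hQ huv hNt
      (fun q hq => hrefl q (Multiset.mem_filter.1 hq).1) (by omega)
    exact ⟨T, hT.trans (by gcongr), hT'⟩

end OddPrime

/-! ### Quadruples of classes in D_4 × C_2 -/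

set_option synthInstance.maxSize 1000 in
set_option synthInstance.maxHeartbeats 400000 in
theorem exists_quad_avoiding : ∀ f g : DihedralTimesC2 2, ∃ u v x : DihedralTimesC2 2,
    [x, x * u * v, u, v].Nodup ∧ (∀ w ∈ [x, x * u * v, u, v], w ≠ f ∧ w ≠ g) ∧
      IsRot u ∧ IsRot v ∧ ¬ IsRot x := by
  decide +kernel

-- For p = 2 an odd rotation class supplies the second kernel value. Four reflections are needed
-- when both odd rotation classes are missing: then u, v and x y all have even angle.
set_option synthInstance.maxSize 1000 in
set_option synthInstance.maxHeartbeats 400000 in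
theorem exists_quad_avoiding_of_odd : ∀ f g : DihedralTimesC2 2, ∃ u v x : DihedralTimesC2 2,
    [x, x * u * v, u, v].Nodup ∧ (∀ w ∈ [x, x * u * v, u, v], w ≠ f ∧ w ≠ g) ∧ ¬ IsRot x ∧
      (IsRot u ∧ IsRot v ∧ (u.1 = .r 1 ∨ v.1 = .r 1 ∨ (u * v).1 = .r 1) ∨
        ¬ IsRot u ∧ ¬ IsRot v ∧ (u * v).1 = .r 1) := by
  decide +kernel

theorem mul_self_ne_one_of_odd : ∀ g : DihedralTimesC2 (2 * 2), (cls (p := 2) g).1 = .r 1 →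
    g * g ≠ 1 := by
  decide +kernel

theorem card_elementary : Fintype.card (DihedralTimesC2 2) = 8 := by decide +kernel

theorem card_le_eight {s : Multiset (DihedralTimesC2 2)} (hs : s.Nodup) : s.card ≤ 8 :=
  card_elementary ▸ Finset.card_le_univ (⟨s, hs⟩ : Finset (DihedralTimesC2 2))

/-- A squarefree sequence of length at least `6` misses at most two elements of `D_4 × C_2`. -/
theorem exists_missing {s : Multiset (DihedralTimesC2 2)} (hs : s.Nodup) (h : 6 ≤ s.card) :
    ∃ f g, ∀ w, w ≠ f ∧ w ≠ g → w ∈ s := by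
  classical
  let B : Finset (DihedralTimesC2 2) := ⟨s, hs⟩
  have hB : Bᶜ.card ≤ 2 := by
    have : 6 ≤ B.card := h
    rw [Finset.card_compl, card_elementary]
    omega
  obtain ⟨f, g, hfg⟩ : ∃ f g, ∀ w ∈ Bᶜ, w = f ∨ w = g := by
    rcases Nat.lt_or_ge Bᶜ.card 2 with h1 | h1
    · obtain ⟨f, hf⟩ := Finset.card_le_one_iff_subset_singleton.1 (Nat.lt_succ_iff.1 h1)
      exact ⟨f, f, fun w hw => Or.inl (Finset.mem_singleton.1 (hf hw))⟩
    · obtain ⟨f, g, -, hfg⟩ := Finset.card_eq_two.1 (le_antisymm hB h1)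
      exact ⟨f, g, fun w hw => by simpa [hfg] using hw⟩
  refine ⟨f, g, fun w hw => ?_⟩
  by_contra hcon
  rcases hfg w (Finset.mem_compl.2 hcon) with h1 | h1
  · exact hw.1 h1
  · exact hw.2 h1

theorem exists_lift_of_nodup {α β : Type*} (f : α → β) {L : Multiset α} {l : List β}
    (hl : l.Nodup) (h : ∀ b ∈ l, b ∈ L.map f) :
    ∃ l' : List α, (l' : Multiset α) ≤ L ∧ l'.map f = l :=
  exists_list_map_eq f l L
    ((Multiset.le_iff_subset (Multiset.coe_nodup.2 hl)).2 fun _ hb => h _ hb)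

theorem exists_lift_four {α β : Type*} (f : α → β) {L : Multiset α} {x y u v : β}
    (hl : [x, y, u, v].Nodup) (h : ∀ b ∈ [x, y, u, v], b ∈ L.map f) :
    ∃ x' y' u' v', {x', y'} + {u', v'} ≤ L ∧ f x' = x ∧ f y' = y ∧ f u' = u ∧ f v' = v := by
  obtain ⟨l', h1, h2⟩ := exists_lift_of_nodup f hl h
  match l', h2 with
  | [x', y', u', v'], h2 =>
    simp only [List.map_cons, List.map_nil, List.cons.injEq, and_true] at h2
    exact ⟨x', y', u', v', h1, h2⟩

/-! ### The case n = 2p and the induction -/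

section Base

variable {p : ℕ}

theorem cls_quad {u v x y : DihedralTimesC2 (2 * p)} (hy : cls y = cls x * cls u * cls v) :
    cls (x * y * (u * v)) = 1 := by
  rw [map_mul, map_mul, map_mul, hy, mul_assoc (cls x) (cls u), ← mul_assoc (cls x),
    mul_self_elementary, one_mul, mul_self_elementary]

theorem isRot_iff_cls {g : DihedralTimesC2 (2 * p)} : IsRot (cls g) ↔ IsRot g :=
  isRot_dihMap _ _

/-- The values x y z w and x y w z differ and lie in a kernel of order at most 2, so one of them is
1. -/
theorem productOne_of_four_refl [Fact p.Prime] {x y z w : DihedralTimesC2 (2 * p)} (hp2 : p ≤ 2)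
    (hy : ¬ IsRot y) (hz : ¬ IsRot z) (hw : ¬ IsRot w) (h1 : cls (x * y * (z * w)) = 1)
    (hne : z * w * (z * w) ≠ 1) : IsProductOne ({x, y} + {z, w}) := by
  have key : IsProductOne ({x, y} + ({z, w} + 0)) := by
    rcases (wide_zero (z := gen p)).inv_mem_or (by omega) h1 (h := x * y * (w * z))
      (by rw [map_mul, map_mul cls w, mul_comm_elementary (cls w), ← map_mul, ← map_mul, h1])
      (fun e => hne (by
        nth_rw 1 [mul_left_cancel e]
        rw [mul_assoc, ← mul_assoc z, mul_self_eq_one hz, one_mul, mul_self_eq_one hw]))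
      with h2 | h2
    · exact productOne_of_quad_of_inv_mem hy (mul_mem_signedSet_refl hz hw) h2
    · exact productOne_of_quad_of_inv_mem hy (mul_swap_mem_signedSet_refl hz hw) h2
  rwa [add_zero] at key

theorem exists_of_two {L : Multiset (DihedralTimesC2 (2 * 2))} (hL : (L.map cls).Nodup)
    (h6 : 6 ≤ L.card) : ∃ T ≤ L, IsProductOne T ∧ T.card = 2 * 2 := by
  have : Fact (Nat.Prime 2) := ⟨Nat.prime_two⟩
  obtain ⟨f, g, hfg⟩ := exists_missing hL (by rwa [Multiset.card_map])
  obtain ⟨u, v, x, hnd, hav, hx, huv⟩ := exists_quad_avoiding_of_odd f g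
  obtain ⟨x, y, u, v, hle, rfl, hy, rfl, rfl⟩ :=
    exists_lift_four (cls (p := 2)) hnd fun b hb => hfg b (hav b hb)
  refine ⟨_, hle, ?_, by simp⟩
  rw [isRot_iff_cls (p := 2)] at hx
  have hyr : IsRot y ↔ (IsRot (cls (p := 2) u) ↔ ¬ IsRot (cls (p := 2) v)) := by
    rw [← isRot_iff_cls (p := 2), hy, isRot_mul_iff, isRot_mul_iff, isRot_iff_cls (p := 2)]
    tauto
  rcases huv with ⟨hu, hv, hodd⟩ | ⟨hu, hv, hodd⟩
  · have hQ : IsQuad (p := 2) u v x y :=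
      ⟨isRot_iff_cls.1 hu, isRot_iff_cls.1 hv, hx, by tauto, cls_quad hy⟩
    have := hQ.productOne_of_ne (wide_zero (z := gen 2)) le_rfl (by
      rcases hodd with h | h | h
      · exact Or.inl (mul_self_ne_one_of_odd _ h)
      · exact Or.inr (Or.inl (mul_self_ne_one_of_odd _ h))
      · refine Or.inr (Or.inr (mul_self_ne_one_of_odd _ ?_))
        rwa [map_mul, hy, mul_assoc (cls x), ← mul_assoc (cls x), mul_self_elementary, one_mul])
    rwa [add_zero] at this
  · refine productOne_of_four_refl (p := 2) le_rfl (by tauto) (mt isRot_iff_cls.2 hu)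
      (mt isRot_iff_cls.2 hv) (cls_quad hy) (mul_self_ne_one_of_odd _ (by rwa [map_mul]))

theorem hasEGZ_two_mul_prime (p : ℕ) (hp : p.Prime) : HasEGZ (2 * p) := by
  have : Fact p.Prime := ⟨hp⟩
  have h2 := hp.two_le
  intro S' hS'
  -- Fixing the length at exactly 4p + 2 makes |L| even, so |L| > 4 will mean |L| ≥ 6.
  obtain ⟨S, hS, hSc⟩ := exists_le_card S' _ hS'
  suffices ∃ T ≤ S, IsProductOne T ∧ T.card = 2 * p by
    obtain ⟨T, hT, hT'⟩ := this
    exact ⟨T, hT.trans hS, hT'⟩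
  obtain ⟨M, L, hML, hM, hL⟩ := exists_pairing (cls (p := p)) S
  replace hML : S = (M.map pairSeq).sum + L := hML
  subst hML
  rw [Multiset.card_add, card_sum_pairSeq] at hSc
  have hL8 := card_le_eight hL
  rw [Multiset.card_map] at hL8
  by_cases hL4 : L.card ≤ 4
  -- Here 2|M| ≥ 4p - 2, so there are at least 2p - 1 pairs.
  · obtain ⟨T, hT, hT1, hTc⟩ := exists_productOne_of_blocks (gen_pow p) (k := 2)
      (M.map fun q => [q.1, q.2]) (by rw [Multiset.card_map]; omega) (by
        intro l hl
        obtain ⟨q, hq, rfl⟩ := Multiset.mem_map.1 hl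
        refine ⟨rfl, ?_⟩
        rw [List.prod_cons, List.prod_singleton]
        exact exists_zpow_of_dihMap_eq_one (Dvd.intro p rfl)
          (show cls (q.1 * q.2) = 1 by rw [map_mul, hM q hq, mul_self_elementary]))
    refine ⟨T, hT.trans ?_, hT1, by omega⟩
    rw [Multiset.map_map]
    exact Multiset.le_add_right _ _
  have hL6 : 6 ≤ L.card := by omega
  rcases hp.eq_two_or_odd' with rfl | hodd
  · obtain ⟨T, hT, hT'⟩ := exists_of_two hL hL6
    exact ⟨T, hT.trans (Multiset.le_add_left _ _), hT'⟩
  obtain ⟨f, g, hfg⟩ := exists_missing hL (by rwa [Multiset.card_map])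
  obtain ⟨u, v, x, hnd, hav, hu, hv, hx⟩ := exists_quad_avoiding f g
  obtain ⟨x, y, u, v, hle, rfl, hy, rfl, rfl⟩ :=
    exists_lift_four (cls (p := p)) hnd fun b hb => hfg b (hav b hb)
  have huv : cls u ≠ cls v := by
    simp only [List.nodup_cons, List.mem_cons] at hnd
    tauto
  have hyr : ¬ IsRot y := by
    rw [← isRot_iff_cls, hy, isRot_mul_iff, isRot_mul_iff]
    tauto
  obtain ⟨T, hT, hT'⟩ := exists_of_pairs_of_quad hodd
    ⟨isRot_iff_cls.1 hu, isRot_iff_cls.1 hv, mt isRot_iff_cls.2 hx, hyr, cls_quad hy⟩ huv hM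
    (by omega)
  refine ⟨T, hT.trans ?_, hT'⟩
  rw [← add_assoc, add_comm]
  gcongr

theorem hasEGZ_two_mul (m : ℕ) (hm : 2 ≤ m) : HasEGZ (2 * m) := by
  induction m using Nat.strong_induction_on with
  | _ m ih =>
    by_cases hp : m.Prime
    · exact hasEGZ_two_mul_prime m hp
    · obtain ⟨k, hk⟩ := Nat.minFac_dvd m
      have hpr := Nat.minFac_prime (show m ≠ 1 by omega)
      have hk0 : k ≠ 0 := by rintro rfl; omega
      have hk1 : k ≠ 1 := by
        rintro rfl
        rw [mul_one] at hk
        exact hp (hk ▸ hpr)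
      have hkm : k < m := by
        have := Nat.mul_lt_mul_of_pos_right hpr.one_lt (Nat.pos_of_ne_zero hk0)
        omega
      have := (ih k hkm (by omega)).mul hpr.pos
      rwa [mul_assoc, mul_comm k, ← hk] at this

end Base

/-! ### The exponent and padding by identities -/

theorem exponent_dihedralTimesC2 {n : ℕ} (heven : Even n) :
    Monoid.exponent (DihedralTimesC2 n) = n := by
  have h2 : Monoid.exponent (Multiplicative (ZMod 2)) = 2 := by
    rw [Monoid.exponent_multiplicative, ZMod.exponent]
  rw [Monoid.exponent_prod, DihedralGroup.exponent, h2]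
  simp only [lcm_eq_nat_lcm, Nat.lcm_assoc, Nat.lcm_self]
  exact Nat.lcm_eq_left heven.two_dvd

theorem prod_filter_ne_one {M : Type*} [Monoid M] [DecidableEq M] (l : List M) :
    (l.filter (· ≠ 1)).prod = l.prod := by
  induction l with
  | nil => rfl
  | cons a l ih =>
    by_cases ha : a = 1
    · rw [List.filter_cons_of_neg (by simpa using ha), ih, ha, List.prod_cons, one_mul]
    · rw [List.filter_cons_of_pos (by simpa using ha), List.prod_cons, ih, List.prod_cons]

/-- Deleting identity terms from a product-one subsequence of `S` extended by `exp(G) - 1`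
identities gives a short product-one subsequence of `S`. -/
theorem exists_short_of_add_replicate_one {G : Type*} [Group G] {S T : Multiset G}
    (hT : T ≤ S + Multiset.replicate (Monoid.exponent G - 1) 1) (hT1 : IsProductOne T)
    (hTc : T.card = Monoid.exponent G) (hpos : 0 < Monoid.exponent G) :
    ∃ T' ≤ S, IsShortProductOne T' := by
  classical
  by_cases h1 : (1 : G) ∈ S
  · exact ⟨{1}, Multiset.singleton_le.2 h1, ⟨[1], rfl, by simp⟩, by simp, hpos⟩
  have hrep : (Multiset.replicate (Monoid.exponent G - 1) (1 : G)).filter (· ≠ 1) = 0 :=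
    Multiset.filter_eq_nil.2 fun a ha h => h (Multiset.eq_of_mem_replicate ha)
  refine ⟨T.filter (· ≠ 1), ?_, ?_, ?_, ?_⟩
  · have := Multiset.filter_le_filter (· ≠ (1 : G)) hT
    rw [Multiset.filter_add, hrep, add_zero] at this
    exact this.trans (Multiset.filter_le _ _)
  · obtain ⟨l, rfl, hl⟩ := hT1
    refine ⟨l.filter (· ≠ 1), by simp, ?_⟩
    rw [prod_filter_ne_one, hl]
  -- T has exp(G) terms, one more than the identities available when 1 ∉ S, so something survives
  -- the deletion.
  · rw [Nat.one_le_iff_ne_zero, Ne, Multiset.card_eq_zero]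
    intro h0
    have hall : ∀ a ∈ T, a = 1 := by simpa [Multiset.filter_eq_nil] using h0
    have hcnt : T.count 1 = T.card := Multiset.count_eq_card.2 fun a ha => (hall a ha).symm
    have := Multiset.count_le_of_le 1 hT
    rw [Multiset.count_add, Multiset.count_eq_zero_of_notMem h1, Multiset.count_replicate_self]
      at this
    omega
  · exact (Multiset.card_le_card (Multiset.filter_le _ _)).trans hTc.le

/-! ### The extremal sequence -/

section Extremal

variable {n : ℕ}

/-- The rotation angle, with junk value for reflections. -/
def angle (g : DihedralTimesC2 n) : ZMod n :=
  match g.1 with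
  | .r i => i
  | .sr i => i

theorem angle_mul {a b : DihedralTimesC2 n} (ha : IsRot a) (hb : IsRot b) :
    angle (a * b) = angle a + angle b := by
  obtain ⟨_, c⟩ := a
  obtain ⟨_, d⟩ := b
  obtain ⟨i, rfl⟩ := ha
  obtain ⟨j, rfl⟩ := hb
  rfl

theorem angle_sum_eq_zero {T : Multiset (DihedralTimesC2 n)} (hT : IsProductOne T)
    (hrot : ∀ g ∈ T, IsRot g) : (T.map angle).sum = 0 := by
  obtain ⟨l, rfl, hl⟩ := hT
  have key : ∀ l : List (DihedralTimesC2 n), (∀ g ∈ l, IsRot g) →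
      IsRot l.prod ∧ angle l.prod = (l.map angle).sum := by
    intro l
    induction l with
    | nil => intro _; exact ⟨isRot_one, rfl⟩
    | cons a l ih =>
      intro h
      obtain ⟨h1, h2⟩ := ih fun g hg => h g (List.mem_cons_of_mem _ hg)
      have ha := h a (by simp)
      rw [List.prod_cons, List.map_cons, List.sum_cons, ← h2]
      exact ⟨ha.mul h1, angle_mul ha h1⟩
  have h := (key l hrot).2
  rw [hl] at h
  exact h.symm

theorem map_prod_eq_one {H : Type*} [CommGroup H] (φ : DihedralTimesC2 n →* H)
    {T : Multiset (DihedralTimesC2 n)} (hT : IsProductOne T) : (T.map φ).prod = 1 := by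
  obtain ⟨l, rfl, hl⟩ := hT
  rw [Multiset.map_coe, Multiset.prod_coe, ← map_list_prod, hl, map_one]

/-- The determinant of the dihedral component. -/
def reflSign (n : ℕ) : DihedralTimesC2 n →* Multiplicative (ZMod 2) where
  toFun g := match g.1 with
    | .r _ => 1
    | .sr _ => Multiplicative.ofAdd 1
  map_one' := rfl
  map_mul' := by
    rintro ⟨i | i, c⟩ ⟨j | j, d⟩ <;> try rfl
    exact (show (1 : Multiplicative (ZMod 2)) =
      Multiplicative.ofAdd 1 * Multiplicative.ofAdd 1 by decide)

theorem reflSign_r (i : ZMod n) (c : Multiplicative (ZMod 2)) :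
    reflSign n (.r i, c) = 1 := rfl

theorem reflSign_sr (i : ZMod n) (c : Multiplicative (ZMod 2)) :
    reflSign n (.sr i, c) = Multiplicative.ofAdd 1 := rfl

theorem angle_r (i : ZMod n) (c : Multiplicative (ZMod 2)) :
    angle ((.r i, c) : DihedralTimesC2 n) = i := rfl

/-- A sequence of length `n + 2` without short product-one subsequences. -/
def extremalSeq (n : ℕ) : Multiset (DihedralTimesC2 n) :=
  Multiset.replicate (n - 1) (.r 1, 1) +
    ({(.r 1, Multiplicative.ofAdd 1), (.r 0, Multiplicative.ofAdd 1)} + {(.sr 0, 1)})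

theorem card_extremalSeq (hn : 1 ≤ n) : (extremalSeq n).card = n + 2 := by
  simp only [extremalSeq, Multiset.card_add, Multiset.card_replicate, Multiset.card_pair,
    Multiset.card_singleton]
  omega

theorem exists_add_of_le_add {α : Type*} {T A B : Multiset α} (h : T ≤ A + B) :
    ∃ T₁ ≤ A, ∃ T₂ ≤ B, T = T₁ + T₂ := by
  classical
  refine ⟨T ∩ A, Multiset.inter_le_right, T - A, ?_, ?_⟩
  · rw [Multiset.sub_le_iff_le_add, add_comm]; exact h
  · rw [add_comm]; exact (Multiset.sub_add_inter T A).symm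

/-- The determinant excludes the single reflection, and the C_2-component forces both or neither of
the two terms nontrivial there. With a copies of the plain rotation, the angle sum is then a + 1 or
a. In the first case a ≥ n - 1 and the length a + 2 exceeds n; in the second 0 < a < n. -/
theorem extremalSeq_not_short (heven : Even n) (hn : 1 ≤ n) {T : Multiset (DihedralTimesC2 n)}
    (hT : T ≤ extremalSeq n) : ¬ IsShortProductOne T := by
  rintro ⟨h1, hpos, hle⟩
  rw [exponent_dihedralTimesC2 heven] at hle
  obtain ⟨T₁, hT₁, T', hT', rfl⟩ := exists_add_of_le_add hT
  obtain ⟨T'', hT'', T₄, hT₄, rfl⟩ := exists_add_of_le_add hT'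
  obtain ⟨T₂, hT₂, T₃, hT₃, rfl⟩ := exists_add_of_le_add
    (A := {(DihedralGroup.r 1, Multiplicative.ofAdd 1)}) (B := {(DihedralGroup.r 0, Multiplicative.ofAdd 1)}) hT''
  obtain ⟨a, ha, rfl⟩ := Multiset.le_replicate_iff.1 hT₁
  have hs := map_prod_eq_one (reflSign n) h1
  have hc := map_prod_eq_one (MonoidHom.snd _ _) h1
  have hang := angle_sum_eq_zero h1
  have hne : (Multiplicative.ofAdd 1 : Multiplicative (ZMod 2)) ≠ 1 := by decide
  simp only [Multiset.card_add, Multiset.card_replicate] at hpos hle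
  simp only [Multiset.map_add, Multiset.prod_add, Multiset.sum_add, Multiset.map_replicate,
    Multiset.prod_replicate, Multiset.sum_replicate, reflSign_r, angle_r, one_pow, one_mul,
    MonoidHom.coe_snd] at hs hc hang
  have hrot : T₄ = 0 → ∀ g ∈ Multiset.replicate a (.r 1, 1) + (T₂ + T₃ + T₄), IsRot g := by
    rintro rfl g hg
    rw [add_zero] at hg
    rcases Multiset.mem_add.1 hg with h | h
    · exact ⟨1, by rw [Multiset.eq_of_mem_replicate h]⟩
    rcases Multiset.mem_add.1 h with h | h
    · exact ⟨1, by rw [Multiset.mem_singleton.1 (Multiset.mem_of_le hT₂ h)]⟩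
    · exact ⟨0, by rw [Multiset.mem_singleton.1 (Multiset.mem_of_le hT₃ h)]⟩
  rcases Multiset.le_singleton.1 hT₄ with rfl | rfl
  · specialize hang (hrot rfl)
    rcases Multiset.le_singleton.1 hT₂ with rfl | rfl <;>
    rcases Multiset.le_singleton.1 hT₃ with rfl | rfl
    · simp only [Multiset.card_zero, Multiset.map_zero, Multiset.sum_zero, add_zero, nsmul_one,
        ZMod.natCast_eq_zero_iff] at hpos hang
      have := Nat.le_of_dvd hpos hang
      omega
    · simp at hc
    · simp at hc
    · simp only [Multiset.card_zero, Multiset.card_singleton, Multiset.map_zero,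
        Multiset.map_singleton, Multiset.sum_singleton, Multiset.sum_zero, add_zero, nsmul_one,
        angle_r] at hle hang
      rw [← Nat.cast_succ, ZMod.natCast_eq_zero_iff] at hang
      have := Nat.le_of_dvd (Nat.succ_pos a) hang
      omega
  · rcases Multiset.le_singleton.1 hT₂ with rfl | rfl <;>
    rcases Multiset.le_singleton.1 hT₃ with rfl | rfl <;>
    simp only [Multiset.map_zero, Multiset.prod_zero, Multiset.map_singleton,
      Multiset.prod_singleton, reflSign_r, reflSign_sr, one_mul] at hs <;>
    exact hne hs

end Extremal

end ProductOne

/-! ### The two constants -/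

open ProductOne in
theorem mainTheorem1 (n : ℕ) (hn : 4 ≤ n) (heven : Even n) :
    ProductOne.egzConstant (ProductOne.DihedralTimesC2 n) = 2 * n + 2 ∧
    ProductOne.etaConstant (ProductOne.DihedralTimesC2 n) = n + 3 ∧
    (ProductOne.egzConstant (ProductOne.DihedralTimesC2 n) : ℤ) =
      (ProductOne.etaConstant (ProductOne.DihedralTimesC2 n) : ℤ) +
        (Monoid.exponent (ProductOne.DihedralTimesC2 n) : ℤ) - 1 := by
  have hexp := exponent_dihedralTimesC2 heven
  have hE : HasEGZ n := by
    obtain ⟨m, rfl⟩ := heven.two_dvd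
    exact hasEGZ_two_mul m (by omega)
  have hcard := card_extremalSeq (show 1 ≤ n by omega)
  have hegz : egzConstant (DihedralTimesC2 n) = 2 * n + 2 := by
    refine IsLeast.csInf_eq ⟨⟨by omega, fun S hS => ?_⟩, ?_⟩
    · rw [hexp]
      exact hE S hS
    · rintro ℓ ⟨-, hℓ⟩
      by_contra! hlt
      -- The padded sequence has length (n + 2) + (n - 1) = 2n + 1.
      obtain ⟨T, hT, hT1, hTc⟩ := hℓ (extremalSeq n +
        Multiset.replicate (Monoid.exponent (DihedralTimesC2 n) - 1) 1) (by
          rw [Multiset.card_add, hcard, Multiset.card_replicate, hexp]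
          omega)
      obtain ⟨T', hT', hT1'⟩ := exists_short_of_add_replicate_one hT hT1 hTc (by omega)
      exact extremalSeq_not_short heven (by omega) hT' hT1'
  have heta : etaConstant (DihedralTimesC2 n) = n + 3 := by
    refine IsLeast.csInf_eq ⟨⟨by omega, fun S hS => ?_⟩, ?_⟩
    · obtain ⟨T, hT, hT1, hTc⟩ := hE (S +
        Multiset.replicate (Monoid.exponent (DihedralTimesC2 n) - 1) 1) (by
          rw [Multiset.card_add, Multiset.card_replicate, hexp]
          omega)
      exact exists_short_of_add_replicate_one hT hT1 (hTc.trans hexp.symm) (by omega)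
    · rintro ℓ ⟨-, hℓ⟩
      by_contra! hlt
      obtain ⟨T, hT, hT1⟩ := hℓ (extremalSeq n) (by omega)
      exact extremalSeq_not_short heven (by omega) hT hT1
  refine ⟨hegz, heta, ?_⟩
  rw [hegz, heta, hexp]
  push_cast
  ring
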